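/- Let $A$ be a finite alphabet, let $A^*$ be the free monoid on $A$ (with empty word $1$), and let $\widehat{A^*}$ be the free profinite monoid on $A$, that is, the projective limit of the finite quotients of $A^*$ (each with the discrete topology). Its elements are called pseudowords; $A^*$ is embedded in $\widehat{A^*}$ and $\overline{L}$ denotes the topological closure in $\widehat{A^*}$ of a language $L\subseteq A^*$. A parse of a word $w\in A^*$ with respect to $X\subseteq A^*$ is a triple $(v,x,u)$ of words with $w=vxu$, $v\in A^*\setminus A^*X$, $x\in X^*$ and $u\in A^*\setminus XA^*$. A parse of a pseudoword $w\in\widehat{A^*}$ with respect to $X$ is a triple $(v,x,u)$ of pseudowords with $w=vxu$, $v\in\widehat{A^*}\setminus\overline{A^*X}$, $x\in\overline{X^*}$ and $u\in\widehat{A^*}\setminus\overline{XA^*}$; the number of such parses is denoted by $\delta_X(w)$. Let $F\subseteq A^*$ be factorial (every factor of an element of $F$ belongs to $F$), and let $X\subseteq F$ be a rational language with finite $F$-degree $d$, i.e. the supremum over $w\in F$ of the number of parses of the word $w$ with respect to $X$ is a finite number $d$ (the supremum of the empty set being $0$). Then $\delta_X(w)\le d$ for every $w\in\overline{F}$, and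 the map $\delta_X\colon\overline{F}\to\{0,1,\dots,d\}$ is continuous for the discrete topology on $\{0,1,\dots,d\}$. If moreover $1\notin X$, then $\delta_X(w)\ge 1$ for every $w\in\overline{F}$, so that $\delta_X$ is a continuous map $\overline{F}\to\{1,\dots,d\}$. -/

import Mathlib

/-- The congruences of finite index on the free monoid `A*`. -/
def FiniteIndexCon (A : Type*) : Type _ :=
  {c : Con (FreeMonoid A) // Finite c.Quotient}

/-- The compatible families in the product of all finite quotients of `A*`. -/
def compatibleFamilies (A : Type*) : Submonoid (∀ c : FiniteIndexCon A, c.1.Quotient) where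
  carrier := {x | ∀ (c d : FiniteIndexCon A) (h : c.1 ≤ d.1), Con.map c.1 d.1 h (x c) = x d}
  one_mem' := fun _ _ _ => map_one _
  mul_mem' := fun {x y} hx hy c d h => by
    rw [Pi.mul_apply, Pi.mul_apply, map_mul, hx c d h, hy c d h]

/-- The free profinite monoid over the alphabet `A`: the projective limit of the finite quotients
of `A*`. Its elements are the pseudowords over `A`. -/
def FreeProfiniteMonoid (A : Type*) : Type _ := compatibleFamilies A

namespace FreeProfiniteMonoid

instance (A : Type*) : Monoid (FreeProfiniteMonoid A) :=
  inferInstanceAs (Monoid (compatibleFamilies A))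

/-- The topology of the projective limit, every finite quotient of `A*` being discrete. -/
instance (A : Type*) : TopologicalSpace (FreeProfiniteMonoid A) :=
  TopologicalSpace.induced (fun x : compatibleFamilies A => x.1)
    (@Pi.topologicalSpace (FiniteIndexCon A) (fun c => c.1.Quotient) (fun _ => ⊥))

/-- The canonical embedding of `A*` into the free profinite monoid over `A`. -/
def ofWord {A : Type*} (w : List A) : FreeProfiniteMonoid A :=
  ⟨fun c => c.1.mk' (FreeMonoid.ofList w), fun _ _ _ => rfl⟩

/-- The topological closure of a language in the free profinite monoid. -/
def closureOf {A : Type*} (L : Language A) : Set (FreeProfiniteMonoid A) :=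
  closure (ofWord '' {w | w ∈ L})

end FreeProfiniteMonoid

/-- A language is factorial if it contains every factor of each of its elements. -/
def Language.IsFactorial {A : Type*} (F : Language A) : Prop :=
  ∀ u v w : List A, u ++ v ++ w ∈ F → v ∈ F

open scoped Computability in
/-- The parses of a word `w` with respect to `X`: the triples `(v, x, u)` with `w = vxu`,
`v ∉ A*X`, `x ∈ X*` and `u ∉ XA*` (`⊤` is the language `A*` of all words). -/
def wordParses {A : Type*} (X : Language A) (w : List A) : Set (List A × List A × List A) :=
  {p | w = p.1 ++ p.2.1 ++ p.2.2 ∧ p.1 ∉ (⊤ : Language A) * X ∧ p.2.1 ∈ X∗ ∧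
    p.2.2 ∉ X * (⊤ : Language A)}

/-- The `F`-degree of `X`: the supremum of the numbers of parses of the words of `F`. -/
noncomputable def fDegree {A : Type*} (F X : Language A) : ℕ∞ :=
  ⨆ w ∈ F, (wordParses X w).encard

open scoped Computability in
/-- The parses of a pseudoword `w` with respect to `X`: the triples `(v, x, u)` of pseudowords with
`w = vxu`, `v` not in the closure of `A*X`, `x` in the closure of `X*` and `u` not in the closure of
`XA*`. -/
def pseudowordParses {A : Type*} (X : Language A) (w : FreeProfiniteMonoid A) :
    Set (FreeProfiniteMonoid A × FreeProfiniteMonoid A × FreeProfiniteMonoid A) :=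
  {p | w = p.1 * p.2.1 * p.2.2 ∧
    p.1 ∉ FreeProfiniteMonoid.closureOf ((⊤ : Language A) * X) ∧
    p.2.1 ∈ FreeProfiniteMonoid.closureOf X∗ ∧
    p.2.2 ∉ FreeProfiniteMonoid.closureOf (X * (⊤ : Language A))}

/-- The number `δ_X(w)` of parses of a pseudoword `w` with respect to `X`. -/
noncomputable def parseCount {A : Type*} (X : Language A) (w : FreeProfiniteMonoid A) : ℕ∞ :=
  (pseudowordParses X w).encard

/-! Everything is tested on the words near a pseudoword. For a regular language, a pseudoword lies
in its closure iff all words close enough to it lie in the language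
(`mem_closureOf_iff_eventually`); this applies to `X∗`, `A*X` and `XA*`. Multiplication of
pseudowords is open (`eventually_exists_append`), so distinct parses of `w` yield as many distinct
parses of every word near `w`. Since words of `F` are near each `w` in the closure of `F`, the bound
by `d` follows.

Conversely, let `w` be a limit of words of `F` with `n` parses each. By compactness these parses
converge along an ultrafilter, and their limits are parses of `w`. If two limits coincided, a cut
point of the limit parse would absorb a nonempty pseudoword `t` on both sides
(`exists_mul_eq_self`). Factoring out `t` repeatedly would give words near `w`, some of them in `F`,
more than `d` parses, which is impossible.

Hence the pseudowords of the closure of `F` with at least `n` parses are exactly the limits of words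
of `F` with at least `n` parses. They form a clopen subset, and the fibres of the parse count are
differences of such subsets. -/

open scoped Computability
open Filter Topology

/-! ### Regular languages, their closure properties and congruences of finite index -/

namespace Language

variable {A : Type*}

/-- The left quotient of a product depends only on the left quotient of the first factor and on the
left quotients of the second one by the suffixes that complete a word of the first one. -/
theorem mem_leftQuotient_mul {L M : Language A} {w y : List A} :
    y ∈ (L * M).leftQuotient w ↔ y ∈ L.leftQuotient w * M ∨
      ∃ Q ∈ {Q | ∃ p ∈ L, ∃ q, p ++ q = w ∧ Q = M.leftQuotient q}, y ∈ Q := by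
  rw [mem_leftQuotient, mem_mul, mem_mul]
  constructor
  · rintro ⟨a, ha, b, hb, hab⟩
    rcases List.append_eq_append_iff.1 hab with ⟨s, hw, hs⟩ | ⟨s, hs, hy⟩
    · exact .inr ⟨_, ⟨a, ha, s, hw.symm, rfl⟩, by rwa [mem_leftQuotient, ← hs]⟩
    · exact .inl ⟨s, by rwa [mem_leftQuotient, ← hs], b, hb, hy.symm⟩
  · rintro (⟨s, hs, b, hb, rfl⟩ | ⟨_, ⟨p, hp, q, rfl, rfl⟩, hy⟩)
    · exact ⟨w ++ s, hs, b, hb, by simp⟩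
    · exact ⟨p, hp, q ++ y, hy, by simp⟩

/-- A left quotient of the product is determined by one left quotient of `L` and a set of left
quotients of `M`, which leaves finitely many choices; the Myhill–Nerode criterion applies. -/
theorem IsRegular.mul {L M : Language A} (hL : L.IsRegular) (hM : M.IsRegular) :
    (L * M).IsRegular := by
  refine .of_finite_range_leftQuotient ?_
  refine ((hL.finite_range_leftQuotient.prod hM.finite_range_leftQuotient.finite_subsets).image
    fun r : Language A × Set (Language A) => {y | y ∈ r.1 * M ∨ ∃ Q ∈ r.2, y ∈ Q}).subset ?_
  rintro _ ⟨w, rfl⟩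
  refine ⟨(L.leftQuotient w, {Q | ∃ p ∈ L, ∃ q, p ++ q = w ∧ Q = M.leftQuotient q}),
    ⟨⟨w, rfl⟩, ?_⟩, ?_⟩
  · rintro _ ⟨p, -, q, -, rfl⟩
    exact ⟨q, rfl⟩
  · exact Set.ext fun y => mem_leftQuotient_mul.symm

/-- When `y` is nonempty, some factor from `X` passes the end of `w`: it reads `q ++ s` with `q` a
suffix of `w` (possibly empty) and `s` a prefix of `y`. -/
theorem append_mem_kstar_iff {X : Language A} {w y : List A} :
    w ++ y ∈ X∗ ↔ (y = [] ∧ w ∈ X∗) ∨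
      ∃ Q ∈ {Q | ∃ p ∈ X∗, ∃ q, p ++ q = w ∧ Q = X.leftQuotient q}, y ∈ Q * X∗ := by
  constructor
  · rintro ⟨l, hl, hX⟩
    induction l generalizing w with
    | nil =>
      simp only [List.flatten_nil, List.append_eq_nil_iff] at hl
      exact .inl ⟨hl.2, hl.1 ▸ nil_mem_kstar X⟩
    | cons a l ih =>
      rw [List.flatten_cons] at hl
      have hl' : ∀ z ∈ l, z ∈ X := fun z hz => hX z (List.mem_cons_of_mem _ hz)
      have ha : a ∈ X := hX a List.mem_cons_self
      rcases List.append_eq_append_iff.1 hl with ⟨s, hs, hy⟩ | ⟨s, hw, hs⟩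
      · exact .inr ⟨_, ⟨[], nil_mem_kstar X, w, rfl, rfl⟩, s, by
          rwa [hs] at ha, _, join_mem_kstar hl', hy.symm⟩
      · have key : ∀ z ∈ X∗, a ++ z ∈ X∗ := by
          rintro _ ⟨m, rfl, hm⟩
          exact ⟨a :: m, by simp, by simpa using ⟨ha, hm⟩⟩
        rcases ih hs.symm hl' with ⟨hy, h⟩ | ⟨_, ⟨p, hp, q, rfl, rfl⟩, h⟩
        · exact .inl ⟨hy, hw ▸ key s h⟩
        · exact .inr ⟨_, ⟨a ++ p, key p hp, q, by simp [hw], rfl⟩, h⟩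
  · have key : ∀ u ∈ X∗, ∀ v ∈ X∗, u ++ v ∈ X∗ := fun u hu v hv => by
      rw [← kstar_mul_kstar X]
      exact append_mem_mul hu hv
    rintro (⟨rfl, hw⟩ | ⟨_, ⟨p, hp, q, rfl, rfl⟩, s, hs, z, hz, rfl⟩)
    · simpa using hw
    · have : q ++ s ∈ X∗ := ⟨[q ++ s], by simp, List.forall_mem_singleton.2 hs⟩
      simpa using key p hp _ (key _ this z hz)

theorem IsRegular.kstar {X : Language A} (hX : X.IsRegular) : (X∗).IsRegular := by
  refine .of_finite_range_leftQuotient ?_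
  refine ((Set.finite_univ (α := Prop)).prod hX.finite_range_leftQuotient.finite_subsets |>.image
    fun r : Prop × Set (Language A) => {y | (y = [] ∧ r.1) ∨ ∃ Q ∈ r.2, y ∈ Q * X∗}).subset ?_
  rintro _ ⟨w, rfl⟩
  refine ⟨(w ∈ X∗, {Q | ∃ p ∈ X∗, ∃ q, p ++ q = w ∧ Q = X.leftQuotient q}),
    ⟨Set.mem_univ _, ?_⟩, ?_⟩
  · rintro _ ⟨p, -, q, -, rfl⟩
    exact ⟨q, rfl⟩
  · exact Set.ext fun y => append_mem_kstar_iff.symm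

theorem isRegular_top : (⊤ : Language A).IsRegular :=
  .of_finite_range_leftQuotient ((Set.finite_singleton (⊤ : Language A)).subset (by
    rintro _ ⟨w, rfl⟩
    rfl))

theorem isRegular_one : (1 : Language A).IsRegular := by
  refine .of_finite_range_leftQuotient ((Set.toFinite {1, 0}).subset ?_)
  rintro _ ⟨w, rfl⟩
  rcases w with _ | ⟨a, w⟩
  · exact .inl rfl
  · refine .inr (Language.ext fun y => ?_)
    simp [mem_one]

/-- A language saturated by a congruence of finite index is regular. -/
theorem isRegular_of_con (c : FiniteIndexCon A) {L : Language A}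
    (h : ∀ u v : List A, c.1 (FreeMonoid.ofList u) (FreeMonoid.ofList v) → u ∈ L → v ∈ L) :
    L.IsRegular := by
  refine .of_finite_range_leftQuotient ?_
  have := c.2
  refine (Set.finite_range fun m : c.1.Quotient =>
    ({y | ∃ u ∈ L, c.1.mk' (FreeMonoid.ofList u) = m * c.1.mk' (FreeMonoid.ofList y)} :
      Language A)).subset ?_
  rintro _ ⟨w, rfl⟩
  refine ⟨c.1.mk' (FreeMonoid.ofList w), Set.ext fun y => ?_⟩
  change (∃ u ∈ L, _) ↔ w ++ y ∈ L
  rw [← map_mul, ← FreeMonoid.ofList_append]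
  exact ⟨fun ⟨u, hu, he⟩ => h u _ ((Con.eq _).1 he) hu, fun hy => ⟨_, hy, rfl⟩⟩

/-- The transition congruence of a deterministic automaton. -/
def _root_.DFA.transitionCon {σ : Type*} (M : DFA A σ) : Con (FreeMonoid A) where
  r u v := ∀ s, M.evalFrom s u.toList = M.evalFrom s v.toList
  iseqv := ⟨fun _ _ => rfl, fun h s => (h s).symm, fun h k s => (h s).trans (k s)⟩
  mul' := fun h k s => by
    rw [FreeMonoid.toList_mul, FreeMonoid.toList_mul, M.evalFrom_of_append,
      M.evalFrom_of_append, h, k]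

/-- A regular language is saturated by a congruence of finite index. -/
theorem IsRegular.exists_con {L : Language A} (hL : L.IsRegular) :
    ∃ c : FiniteIndexCon A, ∀ u v : List A,
      c.1.mk' (FreeMonoid.ofList u) = c.1.mk' (FreeMonoid.ofList v) → (u ∈ L ↔ v ∈ L) := by
  obtain ⟨σ, _, M, rfl⟩ := hL
  refine ⟨⟨M.transitionCon, ?_⟩, fun u v h => ?_⟩
  · refine Finite.of_injective
      (fun q : M.transitionCon.Quotient => Con.liftOn q (fun u s => M.evalFrom s u.toList)
        fun u v h => funext h) ?_
    rintro ⟨u⟩ ⟨v⟩ h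
    exact (Con.eq _).2 (congr_fun h)
  · have : M.eval u = M.eval v := (Con.eq _).1 h M.start
    rw [DFA.mem_accepts, DFA.mem_accepts, this]

end Language

/-! ### Topology of the free profinite monoid and words near a pseudoword -/

namespace FreeProfiniteMonoid

variable {A : Type*}

/-- The value of a pseudoword in a finite quotient of the free monoid. -/
def proj (c : FiniteIndexCon A) (x : FreeProfiniteMonoid A) : c.1.Quotient := x.1 c

theorem proj_ofWord (c : FiniteIndexCon A) (w : List A) :
    proj c (ofWord w) = c.1.mk' (FreeMonoid.ofList w) := rfl

theorem proj_mul (c : FiniteIndexCon A) (x y : FreeProfiniteMonoid A) :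
    proj c (x * y) = proj c x * proj c y := rfl

theorem map_proj {c d : FiniteIndexCon A} (h : c.1 ≤ d.1) (x : FreeProfiniteMonoid A) :
    Con.map c.1 d.1 h (proj c x) = proj d x := x.2 c d h

theorem proj_eq_of_le {c d : FiniteIndexCon A} (h : c.1 ≤ d.1) {x y : FreeProfiniteMonoid A}
    (hxy : proj c x = proj c y) : proj d x = proj d y := by
  rw [← map_proj h, ← map_proj h, hxy]

theorem ofWord_append (u v : List A) : ofWord (u ++ v) = ofWord u * ofWord v := rfl

theorem exists_proj_ofWord (c : FiniteIndexCon A) (x : FreeProfiniteMonoid A) :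
    ∃ w : List A, proj c (ofWord w) = proj c x := by
  obtain ⟨w, hw⟩ := Con.mk'_surjective (proj c x)
  exact ⟨w.toList, hw⟩

/-- A common refinement of finitely many congruences of finite index. -/
theorem exists_le_of_finite {ι : Type*} [Finite ι] (c : ι → FiniteIndexCon A) :
    ∃ d : FiniteIndexCon A, ∀ i, d.1 ≤ (c i).1 := by
  have := fun i => (c i).2
  refine ⟨⟨Con.ker (MonoidHom.pi fun i => (c i).1.mk'), ?_⟩, fun i u v h => ?_⟩
  · exact Finite.of_injective _ (Con.kerLift_injective _)
  · exact (Con.eq _).1 (congr_fun ((Con.ker_rel _).1 h) i)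

theorem exists_le_pair (c d : FiniteIndexCon A) :
    ∃ e : FiniteIndexCon A, e.1 ≤ c.1 ∧ e.1 ≤ d.1 := by
  obtain ⟨e, he⟩ := exists_le_of_finite (fun b : Bool => cond b c d)
  exact ⟨e, he true, he false⟩

/-- The discrete topology on a finite quotient of the free monoid. -/
abbrev discreteQuotient (c : FiniteIndexCon A) : TopologicalSpace c.1.Quotient := ⊥

attribute [local instance] discreteQuotient

theorem discreteTopology_quotient (c : FiniteIndexCon A) : DiscreteTopology c.1.Quotient := ⟨rfl⟩

attribute [local instance] discreteTopology_quotient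

theorem isEmbedding_proj :
    IsEmbedding (fun (x : FreeProfiniteMonoid A) (c : FiniteIndexCon A) => proj c x) :=
  ⟨⟨rfl⟩, fun _ _ h => Subtype.ext h⟩

theorem continuous_proj (c : FiniteIndexCon A) :
    Continuous (proj c : FreeProfiniteMonoid A → c.1.Quotient) :=
  (continuous_apply c).comp isEmbedding_proj.continuous

instance : T2Space (FreeProfiniteMonoid A) := isEmbedding_proj.t2Space

instance : CompactSpace (FreeProfiniteMonoid A) := by
  have := fun c : FiniteIndexCon A => c.2
  refine IsClosedEmbedding.compactSpace ⟨isEmbedding_proj, ?_⟩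
  -- The projective limit is cut out of the compact product by the closed compatibility conditions.
  have : Set.range (fun (x : FreeProfiniteMonoid A) (c : FiniteIndexCon A) => proj c x) =
      ⋂ (c : FiniteIndexCon A) (d : FiniteIndexCon A) (h : c.1 ≤ d.1),
        {x | Con.map c.1 d.1 h (x c) = x d} := by
    ext x
    simp only [Set.mem_iInter]
    exact ⟨by rintro ⟨y, rfl⟩; exact y.2, fun h => ⟨⟨x, h⟩, rfl⟩⟩
  rw [this]
  exact isClosed_iInter fun c => isClosed_iInter fun d => isClosed_iInter fun h =>
    isClosed_eq (continuous_of_discreteTopology.comp (continuous_apply c)) (continuous_apply d)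

instance : ContinuousMul (FreeProfiniteMonoid A) where
  continuous_mul := isEmbedding_proj.continuous_iff.2 <| continuous_pi fun c =>
    (continuous_of_discreteTopology (f := fun p : c.1.Quotient × c.1.Quotient => p.1 * p.2)).comp
      (((continuous_proj c).comp continuous_fst).prodMk ((continuous_proj c).comp continuous_snd))

theorem eventually_proj_eq (c : FiniteIndexCon A) (x : FreeProfiniteMonoid A) :
    ∀ᶠ y in 𝓝 x, proj c y = proj c x :=
  (continuous_proj c).continuousAt.eventually
    ((isOpen_discrete {proj c x}).mem_nhds rfl)

/-- Finitely many finite quotients have a common refinement, so a single quotient describes a basic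
neighbourhood. -/
theorem mem_nhds_iff_proj {x : FreeProfiniteMonoid A} {U : Set (FreeProfiniteMonoid A)} :
    U ∈ 𝓝 x ↔ ∃ c : FiniteIndexCon A, ∀ y, proj c y = proj c x → y ∈ U := by
  refine ⟨fun hU => ?_, fun ⟨c, hc⟩ => mem_of_superset (eventually_proj_eq c x) hc⟩
  rw [isEmbedding_proj.nhds_eq_comap, mem_comap] at hU
  obtain ⟨V, hV, hVU⟩ := hU
  rw [nhds_pi, Filter.mem_pi] at hV
  obtain ⟨I, hI, t, ht, htV⟩ := hV
  have := hI.to_subtype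
  obtain ⟨d, hd⟩ := exists_le_of_finite (fun i : I => i.1)
  refine ⟨d, fun y hy => hVU (htV fun i hi => ?_)⟩
  change proj i y ∈ t i
  rw [proj_eq_of_le (hd ⟨i, hi⟩) hy]
  exact mem_of_mem_nhds (ht i)

/-- The filter of words near a pseudoword. -/
def wordsNear (x : FreeProfiniteMonoid A) : Filter (List A) := comap ofWord (𝓝 x)

theorem eventually_wordsNear {x : FreeProfiniteMonoid A} {P : List A → Prop} :
    (∀ᶠ w in wordsNear x, P w) ↔
      ∃ c : FiniteIndexCon A, ∀ w, proj c (ofWord w) = proj c x → P w := by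
  rw [wordsNear, eventually_comap]
  exact mem_nhds_iff_proj.trans
    ⟨fun ⟨c, h⟩ => ⟨c, fun w hw => h _ hw w rfl⟩,
      fun ⟨c, h⟩ => ⟨c, by rintro _ hy w rfl; exact h w hy⟩⟩

instance (x : FreeProfiniteMonoid A) : (wordsNear x).NeBot := by
  rw [← frequently_true_iff_neBot]
  intro h
  obtain ⟨c, hc⟩ := eventually_wordsNear.1 h
  obtain ⟨w, hw⟩ := exists_proj_ofWord c x
  exact hc w hw trivial

theorem tendsto_ofWord (x : FreeProfiniteMonoid A) : Tendsto ofWord (wordsNear x) (𝓝 x) :=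
  tendsto_comap

theorem tendsto_wordsNear_iff {α : Type*} {l : Filter α} {f : α → List A}
    {x : FreeProfiniteMonoid A} :
    Tendsto f l (wordsNear x) ↔ Tendsto (fun a => ofWord (f a)) l (𝓝 x) :=
  tendsto_comap_iff

theorem mem_closureOf_iff {x : FreeProfiniteMonoid A} {L : Language A} :
    x ∈ closureOf L ↔ ∃ᶠ w in wordsNear x, w ∈ L := by
  rw [closureOf, mem_closure_iff_frequently, wordsNear, frequently_comap]
  simp only [Set.mem_image, Set.mem_ofPred_eq, and_comm]

theorem notMem_closureOf_iff {x : FreeProfiniteMonoid A} {L : Language A} :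
    x ∉ closureOf L ↔ ∀ᶠ w in wordsNear x, w ∉ L := by
  rw [mem_closureOf_iff, not_frequently]

/-- A congruence of finite index saturating `L` makes membership in `L` constant on the words near
`x`. -/
theorem mem_closureOf_iff_eventually {x : FreeProfiniteMonoid A} {L : Language A}
    (hL : L.IsRegular) : x ∈ closureOf L ↔ ∀ᶠ w in wordsNear x, w ∈ L := by
  rw [mem_closureOf_iff]
  refine ⟨fun h => ?_, fun h => h.frequently⟩
  obtain ⟨c, hc⟩ := hL.exists_con
  have hx : ∀ᶠ w in wordsNear x, proj c (ofWord w) = proj c x :=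
    eventually_wordsNear.2 ⟨c, fun _ => id⟩
  obtain ⟨u, hu, hux⟩ := (h.and_eventually hx).exists
  filter_upwards [hx] with w hw
  exact (hc u w (hux.trans hw.symm)).1 hu

theorem tendsto_append (x y : FreeProfiniteMonoid A) :
    Tendsto (fun p : List A × List A => p.1 ++ p.2) (wordsNear x ×ˢ wordsNear y)
      (wordsNear (x * y)) := by
  rw [tendsto_wordsNear_iff]
  exact ((tendsto_ofWord x).comp tendsto_fst).mul ((tendsto_ofWord y).comp tendsto_snd)

/-- Multiplication of pseudowords is open: the words near a product are products of words near the
factors. -/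
theorem eventually_exists_append {x y : FreeProfiniteMonoid A} {P Q : List A → Prop}
    (hP : ∀ᶠ w in wordsNear x, P w) (hQ : ∀ᶠ w in wordsNear y, Q w) :
    ∀ᶠ w in wordsNear (x * y), ∃ u v, u ++ v = w ∧ P u ∧ Q v := by
  obtain ⟨c, hc⟩ := eventually_wordsNear.1 hP
  obtain ⟨d, hd⟩ := eventually_wordsNear.1 hQ
  let K (e : FiniteIndexCon A) (z : FreeProfiniteMonoid A) : Language A :=
    {w | proj e (ofWord w) = proj e z}
  have hK : ∀ e z, (K e z).IsRegular := fun e z => Language.isRegular_of_con e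
    fun u v h hu => ((Con.eq _).2 h).symm.trans hu
  -- The product of the two classes is regular, hence saturated by some `e`. It contains a word `a
  -- ++ b` with the same value as `x * y` modulo `e`, so it contains every word with that value.
  obtain ⟨e, he⟩ := ((hK c x).mul (hK d y)).exists_con
  obtain ⟨c', hc₁, hc₂⟩ := exists_le_pair c e
  obtain ⟨d', hd₁, hd₂⟩ := exists_le_pair d e
  obtain ⟨a, ha⟩ := exists_proj_ofWord c' x
  obtain ⟨b, hb⟩ := exists_proj_ofWord d' y
  refine eventually_wordsNear.2 ⟨e, fun w hw => ?_⟩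
  have hab : proj e (ofWord (a ++ b)) = proj e (ofWord w) := by
    rw [hw, ofWord_append, proj_mul, proj_mul, proj_eq_of_le hc₂ ha, proj_eq_of_le hd₂ hb]
  obtain ⟨u, hu, v, hv, rfl⟩ := (he _ w hab).1
    (Language.append_mem_mul (proj_eq_of_le hc₁ ha) (proj_eq_of_le hd₁ hb))
  exact ⟨u, v, rfl, hc u hu, hd v hv⟩

end FreeProfiniteMonoid

/-! ### Absorption of nonempty pseudowords -/

namespace FreeProfiniteMonoid

variable {A : Type*}

/-- If two different factorizations of the same words have the same limit, then the first factor of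
this limit absorbs on its right, and the second one on its left, some nonempty pseudoword. -/
theorem exists_mul_eq_self {α : Type*} (l : Ultrafilter α) {a b a' b' : α → List A}
    {x y : FreeProfiniteMonoid A} (h : ∀ᶠ i in l, a i ++ b i = a' i ++ b' i)
    (hne : ∀ᶠ i in l, a i ≠ a' i) (ha : Tendsto a l (wordsNear x)) (hb : Tendsto b l (wordsNear y))
    (ha' : Tendsto a' l (wordsNear x)) (hb' : Tendsto b' l (wordsNear y)) :
    ∃ t, x * t = x ∧ t * y = y ∧ t ∉ closureOf (1 : Language A) := by
  -- The case where the first cut comes before the second; `t` is a limit of the words `s` between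
  -- the two cuts.
  have key : ∀ {a b a' b' : α → List A}, (∀ᶠ i in l, ∃ s ≠ [], a' i = a i ++ s ∧ b i = s ++ b' i) →
      Tendsto a l (wordsNear x) → Tendsto b l (wordsNear y) → Tendsto a' l (wordsNear x) →
      Tendsto b' l (wordsNear y) →
      ∃ t, x * t = x ∧ t * y = y ∧ t ∉ closureOf (1 : Language A) := by
    intro a b a' b' hs ha hb ha' hb'
    obtain ⟨s, hs⟩ := hs.choice
    obtain ⟨t, -, ht⟩ := isCompact_univ.ultrafilter_le_nhds (l.map fun i => ofWord (s i)) (by simp)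
    have ht' : Tendsto s l (wordsNear t) := tendsto_wordsNear_iff.2 ht
    rw [tendsto_wordsNear_iff] at ha hb ha' hb'
    refine ⟨t, tendsto_nhds_unique (ha.mul ht) (ha'.congr' ?_),
      tendsto_nhds_unique (Tendsto.mul ht hb') (hb.congr' ?_), ?_⟩
    · filter_upwards [hs] with i hi
      rw [hi.2.1, ofWord_append]
    · filter_upwards [hs] with i hi
      rw [hi.2.2, ofWord_append]
    · rw [mem_closureOf_iff_eventually Language.isRegular_one]
      intro h1
      obtain ⟨i, hi, hi'⟩ := ((ht'.eventually h1).and hs).exists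
      exact hi'.1 hi
  have : ∀ᶠ i in l, (∃ s ≠ [], a' i = a i ++ s ∧ b i = s ++ b' i) ∨
      ∃ s ≠ [], a i = a' i ++ s ∧ b' i = s ++ b i := by
    filter_upwards [h, hne] with i hi hi'
    rcases List.append_eq_append_iff.1 hi with ⟨s, h1, h2⟩ | ⟨s, h1, h2⟩
    · exact .inl ⟨s, by rintro rfl; simp [h1] at hi', h1, h2⟩
    · exact .inr ⟨s, by rintro rfl; simp [h1] at hi', h1, h2⟩
  rcases Ultrafilter.eventually_or.1 this with h | h
  · exact key h ha hb ha' hb'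
  · exact key h ha' hb' ha hb

/-- The words near `x * y` have arbitrarily many factorizations near `(x, y)` as soon as `x` and `y`
absorb a nonempty pseudoword. -/
theorem eventually_exists_finset {x t y : FreeProfiniteMonoid A} (hx : x * t = x) (hy : t * y = y)
    (ht : t ∉ closureOf (1 : Language A)) (n : ℕ) {P Q : List A → Prop}
    (hP : ∀ᶠ w in wordsNear x, P w) (hQ : ∀ᶠ w in wordsNear y, Q w) :
    ∀ᶠ w in wordsNear (x * y), ∃ S : Finset (List A), S.card = n + 1 ∧
      ∀ p ∈ S, ∃ q, p ++ q = w ∧ P p ∧ Q q := by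
  induction n generalizing P Q with
  | zero =>
    filter_upwards [eventually_exists_append hP hQ] with w ⟨p, q, h⟩
    exact ⟨{p}, by simp, by simpa using ⟨q, h⟩⟩
  | succ n ih =>
    -- As `x = x * t` and `y = t * y`, a factorization `(p, s ++ q)` near `(x, y)` with `s` near `t`
    -- can be recut as `(p ++ s, q)`, still near `(x, y)`.
    have hP' : ∀ᶠ w in wordsNear (x * t), P w := by rwa [hx]
    obtain ⟨P₁, hP₁, T, hT, hPT⟩ := eventually_prod_iff.1 ((tendsto_append x t).eventually hP')
    have hQ' := eventually_exists_append (hT.and (notMem_closureOf_iff.1 ht)) hQ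
    rw [hy] at hQ'
    filter_upwards [ih (hP.and hP₁) (hQ.and hQ')] with w ⟨S, hS, hw⟩
    -- Extending the longest prefix in `S` by the nonempty `s` gives a prefix outside `S`.
    obtain ⟨p, hpS, hp⟩ := S.exists_max_image List.length (Finset.card_pos.1 (by omega))
    obtain ⟨_, rfl, ⟨-, hp₁⟩, -, s, q, rfl, ⟨hs, hs1⟩, hq⟩ := hw p hpS
    have hs0 : 0 < s.length := List.length_pos_iff.2 fun h => hs1 h
    refine ⟨S.cons (p ++ s) fun h => ?_, by simp [hS], ?_⟩
    · have := hp _ h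
      rw [List.length_append] at this
      omega
    · intro r hr
      rcases Finset.mem_cons.1 hr with rfl | hr
      · exact ⟨q, by simp, hPT hp₁ hs, hq⟩
      · obtain ⟨q', h1, h2, h3⟩ := hw r hr
        exact ⟨q', h1, h2.1, h3.1⟩

end FreeProfiniteMonoid

theorem Set.natCast_le_encard_iff {α : Type*} {s : Set α} {n : ℕ} :
    (n : ℕ∞) ≤ s.encard ↔ ∃ f : Fin n → α, Function.Injective f ∧ ∀ i, f i ∈ s := by
  constructor
  · intro h
    obtain ⟨t, hts, ht⟩ := Set.exists_subset_encard_eq h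
    have hfin : t.Finite := Set.finite_of_encard_eq_coe ht
    have := hfin.to_subtype
    have hc : Nat.card t = n := by
      rw [Nat.card_coe_set_eq, Set.ncard_def, ht, ENat.toNat_natCast]
    let e := (Finite.equivFinOfCardEq hc).symm
    exact ⟨fun i => e i, Subtype.val_injective.comp e.injective, fun i => hts (e i).2⟩
  · rintro ⟨f, hf, hs⟩
    have := Set.encard_le_encard_of_injOn (s := Set.univ) (t := s) (fun i _ => hs i) hf.injOn
    simpa using this

open FreeProfiniteMonoid

/-! ### Parses of words near a pseudoword -/

section Parses

variable {A : Type*} {X : Language A}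

/-- Every word has a parse with respect to a language without the empty word. -/
theorem wordParses_nonempty (hX : [] ∉ X) (w : List A) : (wordParses X w).Nonempty := by
  suffices h : ∃ x u, w = x ++ u ∧ x ∈ X∗ ∧ u ∉ X * (⊤ : Language A) by
    obtain ⟨x, u, h⟩ := h
    refine ⟨([], x, u), h.1, ?_, h.2⟩
    rintro ⟨a, -, b, hb, hab⟩
    obtain ⟨-, rfl⟩ := List.append_eq_nil_iff.1 hab
    exact hX hb
  induction hn : w.length using Nat.strong_induction_on generalizing w with
  | _ n ih =>
    by_cases hw : w ∈ X * (⊤ : Language A)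
    · obtain ⟨a, ha, b, -, rfl⟩ := hw
      have ha0 : 0 < a.length := List.length_pos_iff.2 fun h => hX (h ▸ ha)
      obtain ⟨x, u, rfl, ⟨l, rfl, hl⟩, hu⟩ :=
        ih b.length (by simp only [List.length_append] at hn; omega) b rfl
      exact ⟨a ++ l.flatten, u, by simp, ⟨a :: l, by simp, by simpa using ⟨ha, hl⟩⟩, hu⟩
    · exact ⟨[], w, rfl, Language.nil_mem_kstar X, hw⟩

/-- The words near a pseudoword have parses near each parse of this pseudoword. -/
theorem eventually_exists_parse (hX : X.IsRegular) {w v x u : FreeProfiniteMonoid A}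
    (h : (v, x, u) ∈ pseudowordParses X w) {P Q R : List A → Prop}
    (hP : ∀ᶠ a in wordsNear v, P a) (hQ : ∀ᶠ a in wordsNear x, Q a)
    (hR : ∀ᶠ a in wordsNear u, R a) :
    ∀ᶠ a in wordsNear w, ∃ r ∈ wordParses X a, P r.1 ∧ Q r.2.1 ∧ R r.2.2 := by
  obtain ⟨rfl, hv, hx, hu⟩ := h
  filter_upwards [eventually_exists_append (eventually_exists_append
    (hP.and (notMem_closureOf_iff.1 hv))
    (hQ.and ((mem_closureOf_iff_eventually hX.kstar).1 hx)))
    (hR.and (notMem_closureOf_iff.1 hu))]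
  rintro _ ⟨_, c, rfl, ⟨a, b, rfl, ha, hb⟩, hc⟩
  exact ⟨(a, b, c), ⟨rfl, ha.2, hb.2, hc.2⟩, ha.1, hb.1, hc.1⟩

/-- The number of parses is lower semicontinuous. -/
theorem eventually_le_encard_wordParses (hX : X.IsRegular) {w : FreeProfiniteMonoid A} {n : ℕ}
    (h : n ≤ parseCount X w) : ∀ᶠ a in wordsNear w, n ≤ (wordParses X a).encard := by
  obtain ⟨f, hf, hfw⟩ := Set.natCast_le_encard_iff.1 h
  -- Disjoint neighbourhoods of the `n` parses keep the parses of nearby words distinct.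
  obtain ⟨U, hU, hd⟩ := (Set.toFinite (Set.range f)).t2_separation
  have : ∀ i, ∀ᶠ a in wordsNear w, ∃ r ∈ wordParses X a,
      (ofWord r.1, ofWord r.2.1, ofWord r.2.2) ∈ U (f i) := by
    intro i
    have hi := (hU (f i)).2.mem_nhds (hU (f i)).1
    obtain ⟨V, hV, W, hW, hVW⟩ := mem_nhds_prod_iff.1 hi
    obtain ⟨Y, hY, Z, hZ, hYZ⟩ := mem_nhds_prod_iff.1 hW
    filter_upwards [eventually_exists_parse hX (hfw i) ((tendsto_ofWord _).eventually hV)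
      ((tendsto_ofWord _).eventually hY) ((tendsto_ofWord _).eventually hZ)]
    rintro a ⟨r, hr, h1, h2, h3⟩
    exact ⟨r, hr, hVW ⟨h1, hYZ ⟨h2, h3⟩⟩⟩
  filter_upwards [eventually_all.2 this] with a ha
  choose g hg hgU using ha
  refine Set.natCast_le_encard_iff.2 ⟨g, fun i j hij => hf ?_, hg⟩
  by_contra hne
  exact Set.disjoint_left.1 (hd ⟨i, rfl⟩ ⟨j, rfl⟩ hne) (hgU i) (hij ▸ hgU j)

/-- If the first factors of the factorizations of `w` that are induced by a parse absorb a nonempty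
pseudoword, then the words near `w` have arbitrarily many parses. -/
theorem eventually_le_encard_wordParses_of_absorb (hX : X.IsRegular)
    {w v x u t : FreeProfiniteMonoid A} (h : (v, x, u) ∈ pseudowordParses X w)
    (ht : t ∉ closureOf (1 : Language A))
    (habs : (v * t = v ∧ t * (x * u) = x * u) ∨ (v * x * t = v * x ∧ t * u = u)) (n : ℕ) :
    ∀ᶠ a in wordsNear w, n + 1 ≤ (wordParses X a).encard := by
  have hcard : ∀ {a : List A} (φ : List A × List A × List A → List A) (S : Finset (List A)),
      S.card = n + 1 → (∀ p ∈ S, ∃ r ∈ wordParses X a, φ r = p) →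
      n + 1 ≤ (wordParses X a).encard := by
    intro a φ S hS hp
    have : (S : Set (List A)) ⊆ φ '' wordParses X a := hp
    calc ((n + 1 : ℕ) : ℕ∞) = (S : Set (List A)).encard := by
          rw [Set.encard_coe_eq_coe_finsetCard, hS]
      _ ≤ (φ '' wordParses X a).encard := Set.encard_le_encard this
      _ ≤ _ := Set.encard_image_le _ _
  obtain ⟨rfl, hv, hx, hu⟩ := h
  have hv' := notMem_closureOf_iff.1 hv
  have hx' := (mem_closureOf_iff_eventually hX.kstar).1 hx
  have hu' := notMem_closureOf_iff.1 hu
  dsimp only at *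
  rcases habs with ⟨h1, h2⟩ | ⟨h1, h2⟩
  · rw [mul_assoc]
    filter_upwards [eventually_exists_finset h1 h2 ht n hv' (eventually_exists_append hx' hu')]
    rintro a ⟨S, hS, hp⟩
    refine hcard (fun r => r.1) S hS fun p hpS => ?_
    obtain ⟨_, rfl, hpX, b, c, rfl, hb, hc⟩ := hp p hpS
    exact ⟨(p, b, c), ⟨by simp, hpX, hb, hc⟩, rfl⟩
  · filter_upwards [eventually_exists_finset h1 h2 ht n (eventually_exists_append hv' hx') hu']
    rintro a ⟨S, hS, hp⟩
    refine hcard (fun r => r.1 ++ r.2.1) S hS fun p hpS => ?_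
    obtain ⟨c, rfl, ⟨b, b', rfl, hb, hb'⟩, hc⟩ := hp p hpS
    exact ⟨(b, b', c), ⟨by simp, hb, hb', hc⟩, rfl⟩

/-- A limit of words of `F` with at least `n` parses has at least `n` parses, if `X` has finite
`F`-degree. -/
theorem le_parseCount_of_mem_closureOf (hX : X.IsRegular) {F : Language A} {d : ℕ}
    (hd : ∀ a ∈ F, (wordParses X a).encard ≤ d) {n : ℕ} {w : FreeProfiniteMonoid A}
    (hw : w ∈ closureOf (A := A) {a | a ∈ F ∧ n ≤ (wordParses X a).encard}) :
    n ≤ parseCount X w := by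
  have hne := frequently_mem_iff_neBot.1 (mem_closureOf_iff.1 hw)
  -- Along an ultrafilter, all components of the chosen parses converge at once.
  let l := Ultrafilter.of (wordsNear w ⊓ 𝓟 {a | a ∈ F ∧ n ≤ (wordParses X a).encard})
  have hl := le_inf_iff.1 (Ultrafilter.of_le
    (wordsNear w ⊓ 𝓟 {a | a ∈ F ∧ n ≤ (wordParses X a).encard}))
  have hlw : Tendsto id l (wordsNear w) := hl.1
  have hlG : ∀ᶠ a in l, a ∈ F ∧ n ≤ (wordParses X a).encard := le_principal_iff.1 hl.2
  obtain ⟨f, hf⟩ := (hlG.mono fun a ha => Set.natCast_le_encard_iff.1 ha.2).choice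
  have hlim : ∀ g : List A → List A, ∃ x, Tendsto g l (wordsNear x) := fun g => by
    obtain ⟨x, -, hx⟩ := isCompact_univ.ultrafilter_le_nhds (l.map fun a => ofWord (g a)) (by simp)
    exact ⟨x, tendsto_wordsNear_iff.2 hx⟩
  choose v hv using fun i => hlim fun a => (f a i).1
  choose x hx using fun i => hlim fun a => (f a i).2.1
  choose u hu using fun i => hlim fun a => (f a i).2.2
  have hmem : ∀ i, (v i, x i, u i) ∈ pseudowordParses X w := by
    intro i
    refine ⟨?_, ?_, ?_, ?_⟩
    · refine tendsto_nhds_unique (tendsto_wordsNear_iff.1 hlw)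
        ((((tendsto_wordsNear_iff.1 (hv i)).mul (tendsto_wordsNear_iff.1 (hx i))).mul
          (tendsto_wordsNear_iff.1 (hu i))).congr' ?_)
      filter_upwards [hf] with a ha
      rw [← ofWord_append, ← ofWord_append, ← (ha.2 i).1, id]
    · rw [mem_closureOf_iff_eventually (Language.isRegular_top.mul hX)]
      intro h
      obtain ⟨a, ha, ha'⟩ := (((hv i).eventually h).and hf).exists
      exact (ha'.2 i).2.1 ha
    · exact mem_closureOf_iff.2 ((hx i).frequently (hf.mono fun a ha => (ha.2 i).2.2.1).frequently)
    · rw [mem_closureOf_iff_eventually (hX.mul Language.isRegular_top)]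
      intro h
      obtain ⟨a, ha, ha'⟩ := (((hu i).eventually h).and hf).exists
      exact (ha'.2 i).2.2.2 ha
  refine Set.natCast_le_encard_iff.2 ⟨fun i => (v i, x i, u i), fun i j hij => ?_, hmem⟩
  by_contra hne'
  simp only [Prod.mk.injEq] at hij
  obtain ⟨h1, h2, h3⟩ := hij
  have hvj : Tendsto (fun a => (f a j).1) l (wordsNear (v i)) := h1 ▸ hv j
  have hxj : Tendsto (fun a => (f a j).2.1) l (wordsNear (x i)) := h2 ▸ hx j
  have huj : Tendsto (fun a => (f a j).2.2) l (wordsNear (u i)) := h3 ▸ hu j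
  have happ : ∀ {g g' : List A → List A} {y z}, Tendsto g l (wordsNear y) →
      Tendsto g' l (wordsNear z) → Tendsto (fun a => g a ++ g' a) l (wordsNear (y * z)) :=
    fun hg hg' => (tendsto_append _ _).comp (hg.prodMk hg')
  -- Two distinct parses of a word differ in at least one of their two cut points; the ultrafilter
  -- selects one that differs throughout.
  have hsplit : ∀ᶠ a in l, (f a i).1 ≠ (f a j).1 ∨ (f a i).1 ++ (f a i).2.1 ≠
      (f a j).1 ++ (f a j).2.1 := by
    filter_upwards [hf] with a ha
    by_contra! h
    have hxx := h.2
    rw [h.1, List.append_cancel_left_eq] at hxx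
    have hw' := (ha.2 i).1.symm.trans (ha.2 j).1
    rw [h.2, List.append_cancel_left_eq] at hw'
    exact hne' (ha.1 (Prod.ext h.1 (Prod.ext hxx hw')))
  have habs : ∃ t, t ∉ closureOf (1 : Language A) ∧
      ((v i * t = v i ∧ t * (x i * u i) = x i * u i) ∨
        (v i * x i * t = v i * x i ∧ t * u i = u i)) := by
    rcases Ultrafilter.eventually_or.1 hsplit with h | h
    · obtain ⟨t, ht1, ht2, ht⟩ := exists_mul_eq_self l (hf.mono fun a ha => by
        rw [← List.append_assoc, ← List.append_assoc, ← (ha.2 i).1, ← (ha.2 j).1]) h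
        (hv i) (happ (hx i) (hu i)) hvj (happ hxj huj)
      exact ⟨t, ht, .inl ⟨ht1, ht2⟩⟩
    · obtain ⟨t, ht1, ht2, ht⟩ := exists_mul_eq_self l (hf.mono fun a ha => by
        rw [← (ha.2 i).1, ← (ha.2 j).1]) h
        (happ (hv i) (hx i)) (hu i) (happ hvj hxj) huj
      exact ⟨t, ht, .inr ⟨ht1, ht2⟩⟩
  obtain ⟨t, ht, habs⟩ := habs
  -- Absorption with `n := d` gives a word of `F` with at least `d + 1` parses.
  obtain ⟨a, ha, ha'⟩ := ((hlw.eventually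
    (eventually_le_encard_wordParses_of_absorb hX (hmem i) ht habs d)).and hlG).exists
  have := ha.trans (hd a ha'.1)
  norm_cast at this
  omega

theorem mem_closureOf_le_encard_wordParses_iff (hX : X.IsRegular) {F : Language A} {d : ℕ}
    (hd : ∀ a ∈ F, (wordParses X a).encard ≤ d) (n : ℕ) {w : FreeProfiniteMonoid A} :
    w ∈ closureOf (A := A) {a | a ∈ F ∧ n ≤ (wordParses X a).encard} ↔
      w ∈ closureOf F ∧ n ≤ parseCount X w := by
  refine ⟨fun h => ⟨?_, le_parseCount_of_mem_closureOf hX hd h⟩, fun ⟨h, hn⟩ => ?_⟩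
  · exact mem_closureOf_iff.2 ((mem_closureOf_iff.1 h).mono fun _ ha => ha.1)
  · exact mem_closureOf_iff.2
      ((mem_closureOf_iff.1 h).and_eventually (eventually_le_encard_wordParses hX hn))

theorem isClopen_le_parseCount (hX : X.IsRegular) {F : Language A} {d : ℕ}
    (hd : ∀ a ∈ F, (wordParses X a).encard ≤ d) (n : ℕ) :
    IsClopen {w : closureOf F | n ≤ parseCount X w.1} := by
  constructor
  · have : {w : closureOf F | n ≤ parseCount X w.1} = Subtype.val ⁻¹'
        closureOf (A := A) {a | a ∈ F ∧ n ≤ (wordParses X a).encard} := by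
      ext w
      exact (and_iff_right w.2).symm.trans (mem_closureOf_le_encard_wordParses_iff hX hd n).symm
    rw [this]
    exact isClosed_closure.preimage continuous_subtype_val
  · refine isOpen_iff_mem_nhds.2 fun w hw => ?_
    -- The words near `w` with `n` parses are also the words near each `y` close to `w`; such a `y`
    -- in the closure of `F` is then a limit of words of `F` with `n` parses.
    have h : ∀ᶠ y in 𝓝 w.1, ∀ᶠ a in wordsNear y, n ≤ (wordParses X a).encard := by
      have := eventually_eventually_nhds.2
        (eventually_comap.1 (eventually_le_encard_wordParses hX hw))
      exact this.mono fun y hy => eventually_comap.2 hy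
    filter_upwards [continuous_subtype_val.continuousAt.eventually h] with y hy
    exact ((mem_closureOf_le_encard_wordParses_iff hX hd n).1 (mem_closureOf_iff.2
      ((mem_closureOf_iff.1 y.2).and_eventually hy))).2

end Parses

theorem propositionp {A : Type*} [Finite A] (F X : Language A) (hF : F.IsFactorial)
    (hXF : X ≤ F) (hX : X.IsRegular) (d : ℕ) (hd : fDegree F X = (d : ℕ∞)) :
    ∃ δ : FreeProfiniteMonoid.closureOf F → ℕ,
      (∀ w, parseCount X w.1 = (δ w : ℕ∞)) ∧
      (∀ w, δ w ≤ d) ∧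
      ([] ∉ X → ∀ w, 1 ≤ δ w) ∧
      Continuous δ := by
  have hd' : ∀ a ∈ F, (wordParses X a).encard ≤ d := fun a ha =>
    hd ▸ le_iSup₂ (f := fun w (_ : w ∈ F) => (wordParses X w).encard) a ha
  have hle : ∀ w : closureOf F, parseCount X w.1 ≤ d := by
    intro w
    by_contra! h
    have h1 : ((d + 1 : ℕ) : ℕ∞) ≤ parseCount X w.1 := by
      simpa using Order.add_one_le_of_lt h
    obtain ⟨a, ha, hn⟩ := ((mem_closureOf_iff.1 w.2).and_eventually
      (eventually_le_encard_wordParses hX h1)).exists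
    have := hn.trans (hd' a ha)
    norm_cast at this
    omega
  have hδ : ∀ w : closureOf F, parseCount X w.1 = ((parseCount X w.1).toNat : ℕ∞) := fun w =>
    (ENat.natCast_toNat (ne_top_of_le_ne_top (ENat.natCast_ne_top d) (hle w))).symm
  refine ⟨fun w => (parseCount X w.1).toNat, hδ, fun w => ?_, fun h w => ?_, ?_⟩
  · have := hle w
    rw [hδ w] at this
    exact_mod_cast this
  -- Every word of `F` has a parse, so `w` is a limit of words of `F` with at least one parse.
  · have : ((1 : ℕ) : ℕ∞) ≤ parseCount X w.1 :=
      ((mem_closureOf_le_encard_wordParses_iff hX hd' 1).1 (mem_closureOf_iff.2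
        ((mem_closureOf_iff.1 w.2).mono fun a ha => ⟨ha, by
          simpa using wordParses_nonempty h a⟩))).2
    rw [hδ w] at this
    exact_mod_cast this
  · refine continuous_discrete_rng.2 fun n => ?_
    -- Each fibre is a difference of two consecutive clopen superlevel sets.
    have : (fun w : closureOf F => (parseCount X w.1).toNat) ⁻¹' {n} =
        {w : closureOf F | (n : ℕ) ≤ parseCount X w.1} \
          {w : closureOf F | ((n + 1 : ℕ) : ℕ∞) ≤ parseCount X w.1} := by
      ext w
      change (parseCount X w.1).toNat = n ↔
        (n : ℕ∞) ≤ parseCount X w.1 ∧ ¬ ((n + 1 : ℕ) : ℕ∞) ≤ parseCount X w.1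
      rw [hδ w, ENat.toNat_natCast, Nat.cast_le, Nat.cast_le]
      omega
    rw [this]
    exact ((isClopen_le_parseCount hX hd' n).diff (isClopen_le_parseCount hX hd' (n + 1))).isOpen
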